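/- Let $G_0$ be a finite connected multigraph (loops and multiple edges allowed) with a fixed orientation of its edges and a length $\ell(e)>0$ for every edge $e$, and let $\Gamma$ be a tropical curve (a compact connected metric space in which every point has a neighbourhood isometric to a star with $n\ge 1$ legs and its path metric, the point being the centre) with model $G_0$: $\Gamma$ is identified with the geometric realization of $G_0$, each edge $e$ being realized by a segment $e\subset\Gamma$ of length $\ell(e)$. On $C_1(G_0,\mathbb R)=\mathbb R^{E(G_0)}$ put $\langle\alpha,\beta\rangle=\sum_e \alpha(e)\beta(e)\ell(e)$. Let $H_1(G_0,\mathbb R)\subset C_1(G_0,\mathbb R)$ be the real cycles (at every vertex, the incoming and outgoing coefficients have the same sum), $H_1(G_0,\mathbb Z)$ the cycles with integer coefficients, and $\pi:C_1(G_0,\mathbb R)\to H_1(G_0,\mathbb R)$ the orthogonal projection. Let $\Omega(\Gamma)=\Omega(G_0)$ be the space of harmonic $1$-forms $\omega=\sum_e\omega_e\,de$ (the $\omega_e$ satisfy the same condition at every vertex), and let $\int_\alpha\in\Omega(\Gamma)^*$ be given by $\int_\alpha\omega=\sum_e\omega_e\alpha(e)\ell(e)$. Put $J(\Gamma)=\Omega(\Gamma)^*/\{\int_\alpha:\alpha\in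 H_1(G_0,\mathbb Z)\}$. The Euclidean norm on $\Omega(\Gamma)^*$ is $\|\int_\alpha\|_{L^2}=\sqrt{\langle\pi(\alpha),\pi(\alpha)\rangle}$, and $J(\Gamma)$ carries the quotient metric (the Euclidean metric). For $p\in\Gamma$ the Abel–Jacobi map $\Phi_p:\Gamma\to J(\Gamma)$ sends $q$ to the class of $\int_{\alpha_P}$, where $\alpha_P$ is the integral $1$-chain of any path $P$ from $p$ to $q$ in any refinement (length-preserving subdivision) of $G_0$ that has $p$ and $q$ as vertices; $\int_{\alpha_P}$ acts on $\Omega(\Gamma)$ by giving each new edge the coefficient of the edge of $G_0$ that it is a piece of. The Foster coefficient of an edge $e$ is $F(e)=\max_{e'}|\pi(e)(e')|$. **Theorem.** For every base point $p\in\Gamma$ and every edge $e$ of $G_0$, the image of the segment $e$ under $\Phi_p:\Gamma\to J(\Gamma)$ has length $\sqrt{\ell(e)F(e)}$ in the Euclidean metric, i.e. the unit-speed parametrization $[0,\ell(e)]\to\Gamma$ of $e$, composed with $\Phi_p$, is a curve of length $\sqrt{\ell(e)F(e)}$. -/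

import Mathlib

universe u v

open scoped Topology

noncomputable section

namespace Tropical

/-- A (finite) weighted graph: a connected multigraph, loops and multiple edges allowed, with a fixed
orientation of the edges and a positive length for every edge. -/
structure WeightedGraph where
  V : Type u
  E : Type u
  [fintypeV : Fintype V]
  [fintypeE : Fintype E]
  [nonemptyV : Nonempty V]
  tail : E → V
  head : E → V
  len : E → ℝ
  len_pos : ∀ e, 0 < len e
  connected : ∀ x y : V, Relation.ReflTransGen
    (fun a b => ∃ e, (tail e = a ∧ head e = b) ∨ (tail e = b ∧ head e = a)) x y

attribute [instance] WeightedGraph.fintypeV WeightedGraph.fintypeE WeightedGraph.nonemptyV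

namespace WeightedGraph

variable (G : WeightedGraph.{u})

/-- Real `1`-chains, identified with functions on the edges. It is a type synonym, because it
carries the inner product weighted by the edge lengths. -/
def C₁ : Type u := G.E → ℝ

instance : AddCommGroup G.C₁ := inferInstanceAs (AddCommGroup (G.E → ℝ))
instance : Module ℝ G.C₁ := inferInstanceAs (Module ℝ (G.E → ℝ))
instance : FiniteDimensional ℝ G.C₁ := inferInstanceAs (FiniteDimensional ℝ (G.E → ℝ))

/-- The inner product `⟨α, β⟩ = ∑ₑ α(e) β(e) ℓ(e)` on real `1`-chains. -/
abbrev chainCore : InnerProductSpace.Core ℝ G.C₁ where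
  inner α β := ∑ e : G.E, α e * β e * G.len e
  conj_inner_symm α β := by
    simp only [conj_trivial]
    exact Finset.sum_congr rfl fun e _ => by ring
  re_inner_nonneg α := by
    simp only [RCLike.re_to_real]
    exact Finset.sum_nonneg fun e _ => mul_nonneg (mul_self_nonneg _) (G.len_pos e).le
  add_left α β γ := by
    rw [← Finset.sum_add_distrib]
    refine Finset.sum_congr rfl fun e _ => ?_
    change (α e + β e) * γ e * G.len e = _
    ring
  smul_left α β r := by
    simp only [conj_trivial, Finset.mul_sum]
    refine Finset.sum_congr rfl fun e _ => ?_
    change (r * α e) * β e * G.len e = _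
    ring
  definite α h := by
    have h0 := (Finset.sum_eq_zero_iff_of_nonneg (fun e _ =>
      mul_nonneg (mul_self_nonneg (α e)) (G.len_pos e).le)).1 h
    funext e
    have h1 := h0 e (Finset.mem_univ e)
    have h2 := (G.len_pos e).ne'
    have h3 : α e = 0 := by simpa [h2] using h1
    exact h3

/-- The Euclidean norm `‖α‖ = √⟨α, α⟩` on real `1`-chains. -/
instance : NormedAddCommGroup G.C₁ :=
  @InnerProductSpace.Core.toNormedAddCommGroup ℝ G.C₁ _ _ _ G.chainCore

instance : InnerProductSpace ℝ G.C₁ := InnerProductSpace.ofCore G.chainCore.toCore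

theorem inner_chain (α β : G.C₁) : inner ℝ α β = ∑ e : G.E, α e * β e * G.len e := rfl

theorem norm_chain (α : G.C₁) : ‖α‖ = √(∑ e : G.E, α e * α e * G.len e) := rfl

open Classical in
/-- The adjoint operator `d^*` from `1`-chains to `0`-chains (functions on the vertices). -/
def dStar : G.C₁ →ₗ[ℝ] (G.V → ℝ) :=
  ({ toFun := fun α x => ∑ e with G.head e = x, α e - ∑ e with G.tail e = x, α e
     map_add' := by
       intro α β
       funext x
       simp only [Pi.add_apply, Finset.sum_add_distrib]
       ring
     map_smul' := by
       intro r α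
       funext x
       simp only [Pi.smul_apply, smul_eq_mul, RingHom.id_apply, ← Finset.mul_sum]
       ring } : (G.E → ℝ) →ₗ[ℝ] (G.V → ℝ))

/-- The real `1`-cycles. -/
def H₁ : Submodule ℝ G.C₁ := LinearMap.ker G.dStar

/-- The integral `1`-cycles: the real cycles all of whose coefficients are integers. -/
def H₁ℤ : AddSubgroup G.C₁ where
  carrier := {α | α ∈ G.H₁ ∧ ∀ e, ∃ n : ℤ, α e = n}
  zero_mem' := ⟨G.H₁.zero_mem, fun _ => ⟨0, by simp; rfl⟩⟩
  add_mem' := by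
    rintro α β ⟨hα, hα'⟩ ⟨hβ, hβ'⟩
    refine ⟨G.H₁.add_mem hα hβ, fun e => ?_⟩
    obtain ⟨m, hm⟩ := hα' e
    obtain ⟨n, hn⟩ := hβ' e
    refine ⟨m + n, ?_⟩
    change α e + β e = _
    rw [hm, hn]
    push_cast
    ring
  neg_mem' := by
    rintro α ⟨hα, hα'⟩
    refine ⟨G.H₁.neg_mem hα, fun e => ?_⟩
    obtain ⟨m, hm⟩ := hα' e
    refine ⟨-m, ?_⟩
    change -α e = _
    rw [hm]
    push_cast
    ring

/-- The orthogonal projection of real `1`-chains onto real `1`-cycles. -/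
def proj : G.C₁ →L[ℝ] G.C₁ := G.H₁.starProjection

open Classical in
/-- The `1`-chain consisting of a single edge. -/
def edgeChain (e : G.E) : G.C₁ := fun e' => if e' = e then 1 else 0

/-- The supremum norm of a `1`-chain: the largest absolute value of a coefficient. -/
def supNorm (α : G.C₁) : ℝ := ⨆ e : G.E, |α e|

/-- The Foster coefficient of an edge: the supremum norm of its projection onto the cycles. -/
def foster (e : G.E) : ℝ := G.supNorm (G.proj (G.edgeChain e))

/-- `1`-forms `∑ ωₑ de`, given by their coefficients. -/
abbrev OneForm : Type u := G.E → ℝ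

open Classical in
/-- The space of harmonic `1`-forms. -/
def Ω : Submodule ℝ G.OneForm where
  carrier := {ω | ∀ x : G.V, ∑ e with G.head e = x, ω e = ∑ e with G.tail e = x, ω e}
  zero_mem' := by intro x; simp
  add_mem' := by
    intro ω η hω hη x
    simp only [Pi.add_apply, Finset.sum_add_distrib]
    rw [hω x, hη x]
  smul_mem' := by
    intro r ω hω x
    simp only [Pi.smul_apply, smul_eq_mul, ← Finset.mul_sum]
    rw [hω x]

/-- The integral of a `1`-form over a `1`-chain: bilinear, with `∫_{e'} de` equal to `ℓ(e)` if
`e = e'` and to `0` otherwise. -/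
def integral (ω : G.OneForm) (α : G.C₁) : ℝ := ∑ e : G.E, ω e * α e * G.len e

/-- The dual space of the space of harmonic `1`-forms. It is a type synonym, because it carries the
Euclidean norm. -/
def ΩDual : Type u := Module.Dual ℝ G.Ω

instance : AddCommGroup G.ΩDual := inferInstanceAs (AddCommGroup (Module.Dual ℝ G.Ω))
instance : Module ℝ G.ΩDual := inferInstanceAs (Module ℝ (Module.Dual ℝ G.Ω))

/-- The integration functional `∫_α` on harmonic `1`-forms attached to a `1`-chain `α`. -/
def integration : G.C₁ →ₗ[ℝ] G.ΩDual where
  toFun α :=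
    { toFun := fun ω => G.integral ω.1 α
      map_add' := by
        intro ω η
        simp only [integral, Submodule.coe_add, Pi.add_apply, ← Finset.sum_add_distrib]
        exact Finset.sum_congr rfl fun e _ => by ring
      map_smul' := by
        intro r ω
        simp only [integral, Submodule.coe_smul, Pi.smul_apply, smul_eq_mul, RingHom.id_apply,
          Finset.mul_sum]
        exact Finset.sum_congr rfl fun e _ => by ring }
  map_add' α β := by
    refine LinearMap.ext fun ω => ?_
    change ∑ e, ω.1 e * (α e + β e) * G.len e =
      ∑ e, ω.1 e * α e * G.len e + ∑ e, ω.1 e * β e * G.len e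
    rw [← Finset.sum_add_distrib]
    exact Finset.sum_congr rfl fun e _ => by ring
  map_smul' r α := by
    refine LinearMap.ext fun ω => ?_
    change ∑ e, ω.1 e * (r * α e) * G.len e = r * ∑ e, ω.1 e * α e * G.len e
    rw [Finset.mul_sum]
    exact Finset.sum_congr rfl fun e _ => by ring

theorem mem_H₁_iff (α : G.C₁) : α ∈ G.H₁ ↔ (α : G.OneForm) ∈ G.Ω := by
  constructor
  · intro h x
    have h1 : G.dStar α x = 0 := by
      rw [LinearMap.mem_ker.1 h]
      rfl
    exact sub_eq_zero.1 h1
  · intro h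
    refine LinearMap.mem_ker.2 (funext fun x => ?_)
    exact sub_eq_zero.2 (h x)

theorem integration_injective_on_cycles :
    Function.Injective (G.integration.comp G.H₁.subtype) := by
  refine (injective_iff_map_eq_zero _).2 ?_
  rintro ⟨α, hα⟩ h
  have h1 : G.integration α = 0 := h
  have h2 : (inner ℝ α α : ℝ) = 0 :=
    LinearMap.congr_fun h1 ⟨α, (G.mem_H₁_iff α).1 hα⟩
  exact Subtype.ext (inner_self_eq_zero.1 h2)

theorem finrank_cycles : Module.finrank ℝ G.H₁ = Module.finrank ℝ G.ΩDual := by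
  have h : Module.finrank ℝ G.ΩDual = Module.finrank ℝ G.Ω := Subspace.dual_finrank_eq
  rw [h]
  exact LinearEquiv.finrank_eq
    { toFun := fun α => ⟨α.1, (G.mem_H₁_iff α.1).1 α.2⟩
      invFun := fun ω => ⟨ω.1, (G.mem_H₁_iff ω.1).2 ω.2⟩
      left_inv := fun _ => rfl
      right_inv := fun _ => rfl
      map_add' := fun _ _ => rfl
      map_smul' := fun _ _ => rfl }

instance : FiniteDimensional ℝ G.ΩDual :=
  inferInstanceAs (FiniteDimensional ℝ (Module.Dual ℝ G.Ω))

/-- The isomorphism `α ↦ ∫_α` from real cycles to the dual of the harmonic `1`-forms. -/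
def cycleEquiv : G.H₁ ≃ₗ[ℝ] G.ΩDual :=
  LinearEquiv.ofInjectiveOfFinrankEq (G.integration.comp G.H₁.subtype)
    G.integration_injective_on_cycles G.finrank_cycles

/-- The Euclidean norm on the dual of the harmonic `1`-forms: the norm of `∫_α` is the norm of the
orthogonal projection of `α` onto the cycles (see `norm_integration`). -/
instance : NormedAddCommGroup G.ΩDual :=
  NormedAddCommGroup.induced G.ΩDual G.H₁ G.cycleEquiv.symm G.cycleEquiv.symm.injective

theorem integration_proj (α : G.C₁) : G.integration (G.proj α) = G.integration α := by
  refine LinearMap.ext fun ω => ?_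
  have h : @inner ℝ G.C₁ _ ω.1 (α - G.proj α) = 0 :=
    Submodule.inner_right_of_mem_orthogonal ((G.mem_H₁_iff ω.1).2 ω.2)
      (Submodule.sub_starProjection_mem_orthogonal α)
  have h2 := (inner_sub_right _ _ _).symm.trans h
  exact (sub_eq_zero.1 h2).symm

theorem norm_integration (α : G.C₁) : ‖G.integration α‖ = ‖G.proj α‖ := by
  have hm : G.proj α ∈ G.H₁ := Submodule.starProjection_apply_mem _ α
  have h : G.cycleEquiv ⟨G.proj α, hm⟩ = G.integration α := G.integration_proj α
  have h2 : ‖G.integration α‖ = ‖G.cycleEquiv.symm (G.integration α)‖ := rfl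
  rw [h2, ← h, LinearEquiv.symm_apply_apply]
  rfl

/-- The image of the integral cycles in the dual of the harmonic `1`-forms. -/
def lattice : AddSubgroup G.ΩDual := G.H₁ℤ.map G.integration.toAddMonoidHom

/-- The real torus of functionals on harmonic `1`-forms modulo integral cycles. Its distance is the
quotient distance: the infimum over all representatives of the Euclidean norm of the difference. -/
abbrev Jac : Type u := G.ΩDual ⧸ G.lattice

variable {G} in
/-- Paths in a weighted graph; each step traverses an edge with or against its orientation. -/
inductive Path (x : G.V) : G.V → Type u
  | nil : Path x x
  | forward (e : G.E) (P : Path x (G.tail e)) : Path x (G.head e)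
  | backward (e : G.E) (P : Path x (G.head e)) : Path x (G.tail e)

/-- The `1`-chain of a path: each edge is counted as often as it is traversed, with signs. -/
def Path.chain {G : WeightedGraph.{u}} {x : G.V} : {y : G.V} → Path x y → G.C₁
  | _, .nil => 0
  | _, .forward e P => P.chain + G.edgeChain e
  | _, .backward e P => P.chain - G.edgeChain e

end WeightedGraph

/-- A tropical curve (metric graph): a compact connected metric space in which every point `p` has a
neighbourhood isometric to a star with `n ≥ 1` half-open legs `[0, r)` glued at their origins,
with the path metric, and with `p` as its centre. The leg number `k` is parametrized by `σ k`. -/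
structure IsTropicalCurve (Γ : Type u) [MetricSpace Γ] : Prop where
  compact : CompactSpace Γ
  connected : ConnectedSpace Γ
  star : ∀ p : Γ, ∃ n : ℕ, 1 ≤ n ∧ ∃ r : ℝ, 0 < r ∧ ∃ σ : Fin n → ℝ → Γ,
    (∀ k, σ k 0 = p) ∧
    (∀ k, ∀ s ∈ Set.Ico 0 r, ∀ t ∈ Set.Ico 0 r, dist (σ k s) (σ k t) = |s - t|) ∧
    (∀ j k, j ≠ k → ∀ s ∈ Set.Ico 0 r, ∀ t ∈ Set.Ico 0 r, dist (σ j s) (σ k t) = s + t) ∧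
    (⋃ k, σ k '' Set.Ico 0 r) ∈ 𝓝 p

/-- A model of `Γ`: a weighted graph `G` together with an identification of `Γ` with the geometric
realization of `G`. Vertices are points of `Γ`, an edge `e` is realized by the unit-speed segment
`seg e` on `[0, ℓ(e)]` from its tail to its head, and every point of `Γ` is either a vertex or an
interior point of a segment, in exactly one way. -/
structure Model (Γ : Type u) [MetricSpace Γ] extends WeightedGraph.{v} where
  pt : V → Γ
  seg : E → ℝ → Γ
  pt_injective : Function.Injective pt
  seg_tail : ∀ e, seg e 0 = pt (tail e)
  seg_head : ∀ e, seg e (len e) = pt (head e)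
  seg_unitSpeed : ∀ e, HasUnitSpeedOn (seg e) (Set.Icc 0 (len e))
  seg_ne_pt : ∀ e, ∀ t ∈ Set.Ioo 0 (len e), ∀ x, seg e t ≠ pt x
  seg_inj : ∀ e, ∀ t ∈ Set.Ioo 0 (len e), ∀ e', ∀ t' ∈ Set.Ioo 0 (len e'),
    seg e t = seg e' t' → e = e' ∧ t = t'
  cover : ∀ q, (∃ x, pt x = q) ∨ ∃ e, ∃ t ∈ Set.Ioo 0 (len e), seg e t = q

namespace Model

variable {Γ : Type u} [MetricSpace Γ]

/-- The model `G` refines `G₀`: the vertices of `G₀` are vertices of `G`, and every segment `e'` of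
`G` is, with its orientation, a piece of the segment `b e'` of `G₀`. -/
structure Refines (G₀ G : Model.{u, v} Γ) (b : G.E → G₀.E) : Prop where
  vertex : ∀ x : G₀.V, ∃ y : G.V, G.pt y = G₀.pt x
  edge : ∀ e' : G.E, ∃ c : ℝ, 0 ≤ c ∧ c + G.len e' ≤ G₀.len (b e') ∧
    ∀ t ∈ Set.Icc 0 (G.len e'), G.seg e' t = G₀.seg (b e') (c + t)

/-- For a `1`-chain `α` on `G`, where `G` refines `G₀` with edge map `b`, the functional `∫_α` as a
functional on the harmonic `1`-forms on `G₀`. A `1`-form `∑ ωₑ de` on `G₀` becomes the `1`-form on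
`G` in which each `de` is replaced by the sum of all `de'` with `b e' = e`. -/
def transfer (G₀ G : Model.{u, v} Γ) (b : G.E → G₀.E) (α : G.C₁) : G₀.ΩDual :=
  ({ toFun := fun ω => G.integral (fun e' => ω.1 (b e')) α
     map_add' := by
       intro ω η
       simp only [WeightedGraph.integral, Submodule.coe_add, Pi.add_apply,
         ← Finset.sum_add_distrib]
       exact Finset.sum_congr rfl fun e _ => by ring
     map_smul' := by
       intro r ω
       simp only [WeightedGraph.integral, Submodule.coe_smul, Pi.smul_apply, smul_eq_mul,
         RingHom.id_apply, Finset.mul_sum]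
       exact Finset.sum_congr rfl fun e _ => by ring } : Module.Dual ℝ G₀.Ω)

/-- `x` is the class of the functional `∫_{α_P}` for some path `P` from `p` to `q` in some
refinement of `G₀` that has `p` and `q` as vertices. -/
def IsAbelJacobiValue (G₀ : Model.{u, v} Γ) (p q : Γ) (x : G₀.Jac) : Prop :=
  ∃ (G : Model.{u, v} Γ) (b : G.E → G₀.E), Refines G₀ G b ∧
    ∃ (y z : G.V) (P : WeightedGraph.Path y z), G.pt y = p ∧ G.pt z = q ∧
      x = QuotientAddGroup.mk (transfer G₀ G b P.chain)

/-- The Abel-Jacobi map with base point `p`. -/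
def abelJacobi (G₀ : Model.{u, v} Γ) (p q : Γ) : G₀.Jac :=
  Classical.epsilon (G₀.IsAbelJacobiValue p q)

end Model

end Tropical

end

/-! On an edge `e` the Abel–Jacobi map is, up to a translation, `t ↦ (t / ℓ(e)) ∫_e` modulo the
lattice: a straight segment of norm `‖π(e)‖` pushed to the torus. The lattice is uniformly discrete,
so the quotient map preserves small distances and the curve has length `‖π(e)‖`
(`eVariationOn_mk_integration`).

It remains to see that `‖π(e)‖² = ℓ(e) F(e)`. Since `π` is an orthogonal projection, `‖π(e)‖² =
⟨π(e), e⟩ = ℓ(e) π(e)(e)`. That `e` itself realizes the maximum in `F(e)` is a maximum principle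
(`abs_proj_edge_le`): `e - π(e)` is the gradient of a potential, so off `e` the flow `π(e)` runs
downhill. What leaves a superlevel set through another edge must come back through `e`.

As the Abel–Jacobi value is picked by `Classical.epsilon`, it must be shown to exist, by
subdividing, and to be unique. Uniqueness comes from a primitive `A : Γ → J`: every path from `p` to
`q` has class `A q - A p`. -/

namespace Tropical

/-! ### Projection of an edge onto the cycles and the Foster coefficient. -/

namespace WeightedGraph

variable {G : WeightedGraph.{u}}

open Classical in
theorem dStar_apply (α : G.C₁) (x : G.V) :
    G.dStar α x = ∑ e with G.head e = x, α e - ∑ e with G.tail e = x, α e := rfl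

open Classical in
theorem dStar_edgeChain (e : G.E) :
    G.dStar (G.edgeChain e) = Pi.single (G.head e) 1 - Pi.single (G.tail e) 1 := by
  funext x
  rw [dStar_apply]
  simp [edgeChain, Pi.single_apply, eq_comm]

open Classical in
theorem Path.dStar_chain {x y : G.V} (P : Path x y) :
    G.dStar P.chain = Pi.single y 1 - Pi.single x 1 := by
  induction P with
  | nil => simp [Path.chain]
  | forward e P ih => rw [Path.chain, map_add, ih, dStar_edgeChain]; abel
  | backward e P ih => rw [Path.chain, map_sub, ih, dStar_edgeChain]; abel

theorem add_apply (α β : G.C₁) (e : G.E) : (α + β) e = α e + β e := rfl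

theorem sub_apply (α β : G.C₁) (e : G.E) : (α - β) e = α e - β e := rfl

theorem edgeChain_integral (e e' : G.E) : ∃ n : ℤ, G.edgeChain e e' = n := by
  unfold edgeChain
  split_ifs
  · exact ⟨1, by simp⟩
  · exact ⟨0, by simp⟩

theorem Path.chain_integral {x y : G.V} (P : Path x y) (e : G.E) : ∃ n : ℤ, P.chain e = n := by
  induction P with
  | nil => exact ⟨0, by rw [Int.cast_zero]; rfl⟩
  | forward e' P ih =>
    obtain ⟨m, hm⟩ := ih
    obtain ⟨n, hn⟩ := edgeChain_integral e' e
    exact ⟨m + n, by rw [Path.chain, add_apply, hm, hn]; push_cast; rfl⟩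
  | backward e' P ih =>
    obtain ⟨m, hm⟩ := ih
    obtain ⟨n, hn⟩ := edgeChain_integral e' e
    exact ⟨m - n, by rw [Path.chain, sub_apply, hm, hn]; push_cast; rfl⟩

theorem nonempty_path (x y : G.V) : Nonempty (Path x y) := by
  induction G.connected x y with
  | refl => exact ⟨.nil⟩
  | tail _ h ih =>
    obtain ⟨P⟩ := ih
    obtain ⟨e, ⟨rfl, rfl⟩ | ⟨rfl, rfl⟩⟩ := h
    · exact ⟨.forward e P⟩
    · exact ⟨.backward e P⟩

variable (G) in
/-- The chain of a chosen path to `x` from a fixed base vertex. -/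
noncomputable def refChain (x : G.V) : G.C₁ :=
  (nonempty_path (Classical.arbitrary G.V) x).some.chain

/-- The cycle formed by an edge and the reference paths to its ends. -/
theorem refChain_edge_mem (e : G.E) :
    G.refChain (G.tail e) + G.edgeChain e - G.refChain (G.head e) ∈ G.H₁ℤ := by
  classical
  refine ⟨LinearMap.mem_ker.2 ?_, fun e' => ?_⟩
  · rw [map_sub, map_add, refChain, refChain, Path.dStar_chain, Path.dStar_chain, dStar_edgeChain]
    abel
  · obtain ⟨l, hl⟩ := Path.chain_integral
      (nonempty_path (Classical.arbitrary G.V) (G.tail e)).some e'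
    obtain ⟨m, hm⟩ := edgeChain_integral e e'
    obtain ⟨n, hn⟩ := Path.chain_integral
      (nonempty_path (Classical.arbitrary G.V) (G.head e)).some e'
    refine ⟨l + m - n, ?_⟩
    rw [sub_apply, add_apply, refChain, refChain, hl, hm, hn]
    push_cast
    rfl

theorem inner_edgeChain (α : G.C₁) (e : G.E) :
    inner ℝ α (G.edgeChain e) = α e * G.len e := by
  classical
  rw [inner_chain]
  simp [edgeChain]

/-- A chain orthogonal to the cycles is a gradient. -/
theorem exists_potential {g : G.C₁} (hg : g ∈ G.H₁ᗮ) :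
    ∃ f : G.V → ℝ, ∀ e, f (G.head e) - f (G.tail e) = g e * G.len e := by
  -- The potential integrates `g` along the reference paths; orthogonality to the cycle closed up by
  -- `e` gives its increment.
  refine ⟨fun x => inner ℝ g (G.refChain x), fun e => ?_⟩
  have h := Submodule.inner_left_of_mem_orthogonal (refChain_edge_mem e).1 hg
  rw [inner_sub_right, inner_add_right, inner_edgeChain] at h
  linarith

open Classical in
/-- A cycle has no net flow into a set of vertices. -/
theorem sum_cut_eq_zero {α : G.C₁} (hα : α ∈ G.H₁) (S : Set G.V) :
    ∑ e, α e * ((if G.head e ∈ S then 1 else 0) - (if G.tail e ∈ S then 1 else 0)) = 0 := by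
  have h : ∀ (a : G.E → ℝ) (F : G.E → G.V), ∑ x with x ∈ S, ∑ e with F e = x, a e =
      ∑ e, a e * (if F e ∈ S then 1 else 0) := by
    intro a F
    simp only [Finset.sum_filter (s := (Finset.univ : Finset G.E))]
    rw [Finset.sum_comm]
    simp
  simp only [mul_sub, Finset.sum_sub_distrib]
  rw [← h α, ← h α, ← Finset.sum_sub_distrib]
  refine Finset.sum_eq_zero fun x _ => ?_
  rw [← dStar_apply, LinearMap.mem_ker.1 hα]
  rfl

theorem proj_mem (α : G.C₁) : G.proj α ∈ G.H₁ := Submodule.starProjection_apply_mem _ α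

/-- Both sides are the inner product of the projection with the edge, since the edge and its
projection differ by a chain orthogonal to cycles. -/
theorem proj_edge_mul_len (e : G.E) :
    G.proj (G.edgeChain e) e * G.len e = ‖G.proj (G.edgeChain e)‖ ^ 2 := by
  rw [← inner_edgeChain, ← real_inner_self_eq_norm_sq]
  have h := Submodule.inner_right_of_mem_orthogonal (proj_mem (G.edgeChain e))
    (Submodule.sub_starProjection_mem_orthogonal (K := G.H₁) (G.edgeChain e))
  rw [inner_sub_right] at h
  exact sub_eq_zero.1 h

theorem proj_edge_nonneg (e : G.E) : 0 ≤ G.proj (G.edgeChain e) e :=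
  nonneg_of_mul_nonneg_left ((proj_edge_mul_len e).symm ▸ sq_nonneg _) (G.len_pos e)

/-- The coefficients of the projection of an edge are dominated by that of the edge itself. -/
theorem abs_proj_edge_le (e e' : G.E) :
    |G.proj (G.edgeChain e) e'| ≤ G.proj (G.edgeChain e) e := by
  classical
  rcases eq_or_ne e' e with rfl | hne
  · rw [abs_of_nonneg (proj_edge_nonneg _)]
  set α := G.proj (G.edgeChain e)
  have hα0 : 0 ≤ α e := proj_edge_nonneg e
  obtain ⟨f, hf⟩ := exists_potential
    (Submodule.sub_starProjection_mem_orthogonal (K := G.H₁) (G.edgeChain e))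
  have hf' : ∀ i, i ≠ e → f (G.head i) - f (G.tail i) = -(α i * G.len i) := by
    intro i hi
    rw [hf i, sub_apply, edgeChain, if_neg hi, zero_sub, neg_mul]
    rfl
  -- Without a potential drop no level set separates the ends of `e'`, but then its coefficient
  -- vanishes.
  rcases eq_or_ne (f (G.head e')) (f (G.tail e')) with heq | hneq
  · have h := hf' e' hne
    rw [heq, sub_self, zero_eq_neg, mul_eq_zero] at h
    rw [h.resolve_right (G.len_pos e').ne', abs_zero]
    exact hα0
  -- Superlevel set at the higher end of `e'`: exactly one end of `e'` lies in it. The flow into it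
  -- through an edge `i` is `w i`.
  set S : Set G.V := {x | max (f (G.head e')) (f (G.tail e')) ≤ f x} with hS
  set w : G.E → ℝ := fun i =>
    α i * ((if G.head i ∈ S then 1 else 0) - (if G.tail i ∈ S then 1 else 0)) with hw
  have hsum : ∑ i, w i = 0 := sum_cut_eq_zero (proj_mem _) S
  -- Downhill flow can leave `S` but not enter it.
  have hwneg : ∀ i, i ≠ e → w i ≤ 0 := by
    intro i hi
    have h1 := hf' i hi
    have hl := G.len_pos i
    simp only [hw, hS, Set.mem_ofPred_eq]
    split_ifs with ha hb hb
    · simp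
    · have : α i * G.len i < 0 := by linarith [not_le.1 hb]
      have := (neg_of_mul_neg_left this hl.le)
      linarith
    · have : 0 < α i * G.len i := by linarith [not_le.1 ha]
      have := (pos_of_mul_pos_left this hl.le)
      linarith
    · simp
  have hwe : w e ≤ α e := by
    simp only [hw]
    split_ifs <;> linarith
  have hwe' : |α e'| = -w e' := by
    rw [← abs_of_nonpos (hwneg e' hne)]
    simp only [hw, hS, Set.mem_ofPred_eq, abs_mul]
    rcases lt_or_gt_of_ne hneq with h | h
    · simp [h.le, h.not_ge]
    · simp [h.le, h.not_ge]
  rw [← Finset.add_sum_erase _ _ (Finset.mem_univ e),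
    ← Finset.add_sum_erase _ _ (Finset.mem_erase.2 ⟨hne, Finset.mem_univ e'⟩)] at hsum
  have hrest : ∑ i ∈ (Finset.univ.erase e).erase e', w i ≤ 0 :=
    Finset.sum_nonpos fun i hi => hwneg i (Finset.mem_erase.1 (Finset.mem_erase.1 hi).2).1
  linarith

theorem foster_eq (e : G.E) : G.foster e = G.proj (G.edgeChain e) e := by
  have : Nonempty G.E := ⟨e⟩
  refine le_antisymm (ciSup_le fun e' => abs_proj_edge_le e e') ?_
  refine (le_abs_self _).trans (le_ciSup (f := fun e' => |G.proj (G.edgeChain e) e'|) ?_ e)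
  exact (Set.finite_range _).bddAbove

theorem norm_proj_edge (e : G.E) :
    ‖G.proj (G.edgeChain e)‖ = √(G.len e * G.foster e) := by
  rw [foster_eq, mul_comm, proj_edge_mul_len, Real.sqrt_sq (norm_nonneg _)]

end WeightedGraph

end Tropical

/-! ### Lengths of curves and the discrete quotient. -/

namespace Tropical

/-- A curve in a metric space that scales small distances by `c` has constant speed `c`. -/
theorem eVariationOn_Icc_of_locally_scaling {X : Type*} [PseudoMetricSpace X] {γ : ℝ → X}
    {L c δ : ℝ} (hL : 0 ≤ L) (hc : 0 ≤ c) (hδ : 0 < δ)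
    (hle : ∀ s ∈ Set.Icc 0 L, ∀ t ∈ Set.Icc 0 L, dist (γ s) (γ t) ≤ c * |s - t|)
    (heq : ∀ s ∈ Set.Icc 0 L, ∀ t ∈ Set.Icc 0 L, |s - t| < δ → dist (γ s) (γ t) = c * |s - t|) :
    eVariationOn γ (Set.Icc 0 L) = ENNReal.ofReal (c * L) := by
  apply le_antisymm
  · have hlip : LipschitzOnWith c.toNNReal γ (Set.Icc 0 L) := by
      refine LipschitzOnWith.of_dist_le_mul fun s hs t ht => ?_
      rw [Real.coe_toNNReal c hc, Real.dist_eq]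
      exact hle s hs t ht
    have h := hlip.comp_eVariationOn_le (g := id) (Set.mapsTo_id (Set.Icc 0 L))
    have h2 : eVariationOn (id : ℝ → ℝ) (Set.Icc 0 L) = ENNReal.ofReal L := by
      have h3 := (monotone_id.monotoneOn (Set.Icc 0 L)).eVariationOn_eq
        (Set.left_mem_Icc.2 hL) (Set.right_mem_Icc.2 hL)
      rwa [Set.inter_self, id, id, sub_zero] at h3
    calc eVariationOn γ (Set.Icc 0 L) ≤ c.toNNReal * eVariationOn (id : ℝ → ℝ) (Set.Icc 0 L) := h
      _ = ENNReal.ofReal (c * L) := by rw [h2]; exact (ENNReal.ofReal_mul hc).symm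
  -- Cut into `n` equal steps shorter than `δ`, on each of which the distance is exact.
  · obtain ⟨n, hn⟩ := exists_nat_gt (L / δ)
    have hn0 : (0 : ℝ) < n := lt_of_le_of_lt (by positivity) hn
    set u : ℕ → ℝ := fun i => i * (L / n) with hu
    have hstep : 0 ≤ L / n := by positivity
    have hmem : ∀ i ≤ n, u i ∈ Set.Icc 0 L := by
      intro i hi
      refine ⟨by positivity, ?_⟩
      calc (i : ℝ) * (L / n) ≤ n * (L / n) := by gcongr
        _ = L := by field_simp
    have hdiff : ∀ i, |u (i + 1) - u i| = L / n := by
      intro i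
      rw [← abs_of_nonneg hstep]
      congr 1
      simp only [hu]
      push_cast
      ring
    have hmono : Monotone u := fun i j hij => by
      simp only [hu]
      gcongr
    have hsmall : L / n < δ := by
      rw [div_lt_iff₀ hδ] at hn
      rw [div_lt_iff₀ hn0]
      linarith
    refine le_trans (le_of_eq ?_)
      (eVariationOn.sum_le_of_monotoneOn_Iic (f := γ) (n := n) (hmono.monotoneOn _) hmem)
    rw [Finset.sum_congr rfl (g := fun _ => ENNReal.ofReal (c * (L / n)))]
    · rw [Finset.sum_const, Finset.card_range, nsmul_eq_mul, ← ENNReal.ofReal_natCast,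
        ← ENNReal.ofReal_mul hn0.le]
      congr 1
      field_simp
    · intro i hi
      have hi' := Finset.mem_range.1 hi
      rw [edist_dist, heq _ (hmem _ hi') _ (hmem _ hi'.le) (by rw [hdiff]; exact hsmall), hdiff]

/-- The quotient by a uniformly discrete subgroup preserves small norms. -/
theorem norm_mk_eq_of_discrete {M : Type*} [SeminormedAddCommGroup M] {S : AddSubgroup M} {δ : ℝ}
    (hS : ∀ l ∈ S, l ≠ 0 → δ ≤ ‖l‖) {v : M} (hv : 2 * ‖v‖ ≤ δ) :
    ‖(QuotientAddGroup.mk v : M ⧸ S)‖ = ‖v‖ := by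
  refine le_antisymm QuotientAddGroup.norm_mk_le_norm ?_
  rw [QuotientAddGroup.norm_mk]
  refine (Metric.le_infDist ⟨0, S.zero_mem⟩).2 fun l hl => ?_
  -- For `l ≠ 0`, `‖v - l‖ ≥ δ - ‖v‖ ≥ ‖v‖`, so the nearest element of `S` can be taken to be `0`.
  rcases eq_or_ne l 0 with rfl | h0
  · rw [dist_zero_right]
  · have h1 := hS l hl h0
    have h2 := norm_sub_norm_le l v
    rw [dist_eq_norm, norm_sub_rev]
    linarith

namespace WeightedGraph

variable (G : WeightedGraph.{u})

/-- Nonzero elements of the lattice have norm bounded from below. -/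
theorem exists_le_norm_of_mem_lattice :
    ∃ δ : ℝ, 0 < δ ∧ ∀ l ∈ G.lattice, l ≠ 0 → δ ≤ ‖l‖ := by
  obtain ⟨m, hm, hml⟩ : ∃ m : ℝ, 0 < m ∧ ∀ e, m ≤ G.len e := by
    rcases isEmpty_or_nonempty G.E with h | h
    · exact ⟨1, one_pos, fun e => h.elim e⟩
    · obtain ⟨e, he⟩ := Finite.exists_min G.len
      exact ⟨G.len e, G.len_pos e, he⟩
  -- A nonzero integral cycle has a coefficient of square at least `1`, on an edge of length at
  -- least `m`.
  refine ⟨√m, Real.sqrt_pos.2 hm, ?_⟩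
  rintro _ ⟨α, ⟨hα, hαz⟩, rfl⟩ h0
  change √m ≤ ‖G.integration α‖
  have hproj : G.proj α = α := Submodule.starProjection_eq_self_iff.2 hα
  rw [norm_integration, hproj, norm_chain]
  obtain ⟨e, he⟩ : ∃ e, α e ≠ 0 := by
    by_contra! h
    exact h0 (by rw [show α = 0 from funext h, map_zero])
  refine Real.sqrt_le_sqrt ?_
  obtain ⟨k, hk⟩ := hαz e
  have hk0 : k ≠ 0 := by
    rintro rfl
    exact he (by simpa using hk)
  have hk1 : (1 : ℝ) ≤ α e * α e := by
    rw [hk]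
    exact_mod_cast Int.add_one_le_iff.2 (mul_self_pos.2 hk0)
  calc m ≤ 1 * G.len e := by rw [one_mul]; exact hml e
    _ ≤ α e * α e * G.len e := mul_le_mul_of_nonneg_right hk1 (G.len_pos e).le
    _ ≤ _ := Finset.single_le_sum (f := fun e => α e * α e * G.len e)
      (fun i _ => mul_nonneg (mul_self_nonneg _) (G.len_pos i).le) (Finset.mem_univ e)

/-- The length of the image of a straight segment in the torus. -/
theorem eVariationOn_mk_integration (x : G.Jac) (α β : G.C₁) {L : ℝ} (hL : 0 < L) :
    eVariationOn (fun t : ℝ => QuotientAddGroup.mk (G.integration (α + (t / L) • β)) - x)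
      (Set.Icc 0 L) = ENNReal.ofReal ‖G.proj β‖ := by
  obtain ⟨δ, hδ, hlat⟩ := G.exists_le_norm_of_mem_lattice
  set c := ‖G.proj β‖
  have hc0 : 0 ≤ c := norm_nonneg _
  have hdist : ∀ s t : ℝ, dist
      ((QuotientAddGroup.mk (G.integration (α + (s / L) • β)) : G.Jac) - x)
      (QuotientAddGroup.mk (G.integration (α + (t / L) • β)) - x) =
      ‖(QuotientAddGroup.mk (G.integration (((s - t) / L) • β)) : G.Jac)‖ := by
    intro s t
    rw [dist_sub_right, dist_eq_norm, ← QuotientAddGroup.mk_sub, ← map_sub, add_sub_add_left_eq_sub,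
      ← sub_smul, sub_div]
  have hnorm : ∀ r : ℝ, ‖G.integration ((r / L) • β)‖ = c / L * |r| := by
    intro r
    rw [norm_integration, map_smul, norm_smul, Real.norm_eq_abs, abs_div, abs_of_pos hL]
    ring
  -- The radius ensures `2 (c / L) |s - t| ≤ δ`; the `+ 1` keeps it meaningful when `c = 0`.
  rw [eVariationOn_Icc_of_locally_scaling (c := c / L) (δ := δ / (2 * (c / L + 1))) hL.le
    (by positivity) (by positivity), div_mul_cancel₀ _ hL.ne']
  · intro s _ t _
    rw [hdist, ← hnorm]
    exact QuotientAddGroup.norm_mk_le_norm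
  · intro s _ t _ hst
    rw [hdist, norm_mk_eq_of_discrete hlat, hnorm]
    rw [hnorm]
    have h1 : 0 ≤ c / L := by positivity
    rw [lt_div_iff₀ (by positivity)] at hst
    nlinarith [abs_nonneg (s - t)]

end WeightedGraph

end Tropical

/-! ### The primitive on the curve, refinements, and the Abel–Jacobi map. -/

namespace Tropical

theorem _root_.HasUnitSpeedOn.comp_const_add {X : Type*} [PseudoEMetricSpace X] {γ : ℝ → X}
    {a b L : ℝ} (h : HasUnitSpeedOn γ (Set.Icc 0 L)) (ha : 0 ≤ a) (hb : a + b ≤ L) :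
    HasUnitSpeedOn (fun s => γ (a + s)) (Set.Icc 0 b) := by
  intro x hx y hy
  have hx' : a + x ∈ Set.Icc 0 L := ⟨by linarith [hx.1], by linarith [hx.2]⟩
  have hy' : a + y ∈ Set.Icc 0 L := ⟨by linarith [hy.1], by linarith [hy.2]⟩
  have h1 := h hx' hy'
  rw [Set.inter_eq_right.2 (Set.Icc_subset_Icc hx'.1 hy'.2), add_sub_add_left_eq_sub] at h1
  rw [Set.inter_eq_right.2 (Set.Icc_subset_Icc hx.1 hy.2), ← h1,
    ← Set.image_const_add_Icc a x y]
  exact eVariationOn.comp_eq_of_monotoneOn γ (fun s => a + s)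
    (fun _ _ _ _ hst => by simpa using hst)

namespace Model

variable {Γ : Type u} [MetricSpace Γ] (G₀ : Model.{u, v} Γ)

/-- The class in the torus of the straight path to a point of an edge. -/
noncomputable def edgePoint (e : G₀.E) (t : ℝ) : G₀.Jac :=
  QuotientAddGroup.mk (G₀.integration (G₀.refChain (G₀.tail e) + (t / G₀.len e) • G₀.edgeChain e))

/-- The class in the torus of the reference path to a vertex. -/
noncomputable def vertexPoint (x : G₀.V) : G₀.Jac := QuotientAddGroup.mk (G₀.integration (G₀.refChain x))

theorem edgePoint_zero (e : G₀.E) : G₀.edgePoint e 0 = G₀.vertexPoint (G₀.tail e) := by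
  rw [edgePoint, zero_div, zero_smul, add_zero, vertexPoint]

/-- The two routes to the head differ by an integral cycle, which dies in the torus; this lets the
edge formulas glue at the vertices. -/
theorem edgePoint_len (e : G₀.E) : G₀.edgePoint e (G₀.len e) = G₀.vertexPoint (G₀.head e) := by
  rw [edgePoint, div_self (G₀.len_pos e).ne', one_smul, vertexPoint, eq_comm, QuotientAddGroup.eq,
    ← map_neg, ← map_add, neg_add_eq_sub]
  exact ⟨_, WeightedGraph.refChain_edge_mem e, rfl⟩

/-- There is a map to the torus that is given on every edge by `edgePoint`. -/
theorem exists_torus_map : ∃ A : Γ → G₀.Jac,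
    ∀ e, ∀ t ∈ Set.Icc 0 (G₀.len e), A (G₀.seg e t) = G₀.edgePoint e t := by
  have htot : ∀ q, ∃ y, (∃ x, G₀.pt x = q ∧ y = G₀.vertexPoint x) ∨
      ∃ e, ∃ t ∈ Set.Ioo 0 (G₀.len e), G₀.seg e t = q ∧ y = G₀.edgePoint e t := by
    intro q
    obtain ⟨x, hx⟩ | ⟨e, t, ht, h⟩ := G₀.cover q
    · exact ⟨_, .inl ⟨x, hx, rfl⟩⟩
    · exact ⟨_, .inr ⟨e, t, ht, h, rfl⟩⟩
  choose A hA using htot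
  -- The choice was harmless: a point has only one description as a vertex or interior point.
  have hpt : ∀ x, A (G₀.pt x) = G₀.vertexPoint x := by
    intro x
    obtain ⟨y, hy, h⟩ | ⟨e, t, ht, h, -⟩ := hA (G₀.pt x)
    · rw [h, G₀.pt_injective hy]
    · exact absurd h (G₀.seg_ne_pt e t ht x)
  refine ⟨A, fun e t ht => ?_⟩
  rcases ht.1.eq_or_lt with rfl | h0
  · rw [G₀.seg_tail, hpt, edgePoint_zero]
  rcases ht.2.eq_or_lt with rfl | h1
  · rw [G₀.seg_head, hpt, edgePoint_len]
  obtain ⟨y, hy, -⟩ | ⟨e', t', ht', h, h'⟩ := hA (G₀.seg e t)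
  · exact absurd hy.symm (G₀.seg_ne_pt e t ⟨h0, h1⟩ y)
  · obtain ⟨rfl, rfl⟩ := G₀.seg_inj e' t' ht' e t ⟨h0, h1⟩ h
    exact h'

variable {G₀}

theorem transfer_add (G : Model.{u, v} Γ) (b : G.E → G₀.E) (α β : G.C₁) :
    transfer G₀ G b (α + β) = transfer G₀ G b α + transfer G₀ G b β := by
  refine LinearMap.ext fun ω => ?_
  change ∑ i, ω.1 (b i) * (α i + β i) * G.len i =
    ∑ i, ω.1 (b i) * α i * G.len i + ∑ i, ω.1 (b i) * β i * G.len i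
  rw [← Finset.sum_add_distrib]
  exact Finset.sum_congr rfl fun i _ => by ring

theorem transfer_sub (G : Model.{u, v} Γ) (b : G.E → G₀.E) (α β : G.C₁) :
    transfer G₀ G b (α - β) = transfer G₀ G b α - transfer G₀ G b β := by
  rw [eq_sub_iff_add_eq, ← transfer_add, sub_add_cancel]

theorem transfer_zero (G : Model.{u, v} Γ) (b : G.E → G₀.E) : transfer G₀ G b 0 = 0 := by
  simpa using transfer_sub (G₀ := G₀) G b 0 0

/-- A form is constant along an edge, so a piece contributes in proportion to its length. -/
theorem transfer_edgeChain (G : Model.{u, v} Γ) (b : G.E → G₀.E) (i : G.E) :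
    transfer G₀ G b (G.edgeChain i) =
      G₀.integration ((G.len i / G₀.len (b i)) • G₀.edgeChain (b i)) := by
  classical
  refine LinearMap.ext fun ω => ?_
  change ∑ j, ω.1 (b j) * (if j = i then 1 else 0) * G.len j =
    ∑ j, ω.1 j * (G.len i / G₀.len (b i) * (if j = b i then 1 else 0)) * G₀.len j
  have := (G₀.len_pos (b i)).ne'
  simp
  field_simp

/-- On an edge of a refinement, a torus map changes by the integral over the edge. -/
theorem mk_transfer_edgeChain {A : Γ → G₀.Jac}
    (hA : ∀ e, ∀ t ∈ Set.Icc 0 (G₀.len e), A (G₀.seg e t) = G₀.edgePoint e t)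
    {G : Model.{u, v} Γ} {b : G.E → G₀.E} (hG : Refines G₀ G b) (i : G.E) :
    (QuotientAddGroup.mk (transfer G₀ G b (G.edgeChain i)) : G₀.Jac) =
      A (G.pt (G.head i)) - A (G.pt (G.tail i)) := by
  obtain ⟨c, hc, hcl, hseg⟩ := hG.edge i
  have hl := (G.len_pos i).le
  rw [← G.seg_head, ← G.seg_tail, hseg _ (Set.right_mem_Icc.2 hl), hseg _ (Set.left_mem_Icc.2 hl),
    hA _ _ ⟨by linarith, hcl⟩, hA _ _ ⟨by linarith, by linarith⟩, edgePoint, edgePoint,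
    ← QuotientAddGroup.mk_sub, ← map_sub, add_sub_add_left_eq_sub, ← sub_smul, transfer_edgeChain]
  congr 4
  ring

/-- The integral over a path in a refinement depends only on the ends of the path. -/
theorem mk_transfer_chain {A : Γ → G₀.Jac}
    (hA : ∀ e, ∀ t ∈ Set.Icc 0 (G₀.len e), A (G₀.seg e t) = G₀.edgePoint e t)
    {G : Model.{u, v} Γ} {b : G.E → G₀.E} (hG : Refines G₀ G b) {y z : G.V}
    (P : WeightedGraph.Path y z) :
    (QuotientAddGroup.mk (transfer G₀ G b P.chain) : G₀.Jac) = A (G.pt z) - A (G.pt y) := by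
  induction P with
  | nil => rw [WeightedGraph.Path.chain, transfer_zero, sub_self]; rfl
  | forward e P ih =>
    rw [WeightedGraph.Path.chain, transfer_add, QuotientAddGroup.mk_add, ih,
      mk_transfer_edgeChain hA hG]
    abel
  | backward e P ih =>
    rw [WeightedGraph.Path.chain, transfer_sub, QuotientAddGroup.mk_sub, ih,
      mk_transfer_edgeChain hA hG]
    abel

theorem Refines.refl (G : Model.{u, v} Γ) : Refines G G id where
  vertex x := ⟨x, rfl⟩
  edge e := ⟨0, le_rfl, by simp, fun t _ => by simp⟩

theorem Refines.trans {G G' : Model.{u, v} Γ} {b : G.E → G₀.E} {b' : G'.E → G.E}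
    (h : Refines G₀ G b) (h' : Refines G G' b') : Refines G₀ G' (b ∘ b') where
  vertex x := by
    obtain ⟨y, hy⟩ := h.vertex x
    obtain ⟨z, hz⟩ := h'.vertex y
    exact ⟨z, hz.trans hy⟩
  edge e := by
    obtain ⟨c', hc', hl', hs'⟩ := h'.edge e
    obtain ⟨c, hc, hl, hs⟩ := h.edge (b' e)
    refine ⟨c + c', by linarith, by rw [Function.comp_apply]; linarith, fun t ht => ?_⟩
    rw [hs' t ht, hs _ ⟨by linarith [ht.1], by linarith [ht.2]⟩, add_assoc, Function.comp_apply]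

open Classical in
/-- The subdivision of a model at an interior point of an edge. The edge is replaced by its part
before the point (under its old name) and its part after the point. -/
noncomputable def subdivide (G : Model.{u, v} Γ) (e : G.E) (t : ℝ) (ht : t ∈ Set.Ioo 0 (G.len e)) :
    Model.{u, v} Γ where
  V := Option G.V
  E := Option G.E
  tail := fun i => i.elim none fun i => some (G.tail i)
  head := fun i => i.elim (some (G.head e)) fun i => if i = e then none else some (G.head i)
  len := fun i => i.elim (G.len e - t) fun i => if i = e then t else G.len i
  len_pos := by
    rintro (_ | i)
    · exact sub_pos.2 ht.2
    · change 0 < if i = e then t else G.len i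
      split_ifs
      · exact ht.1
      · exact G.len_pos i
  connected := by
    set r : Option G.V → Option G.V → Prop := fun a b => ∃ i : Option G.E,
      ((i.elim none fun i => some (G.tail i)) = a ∧
        (i.elim (some (G.head e)) fun i => if i = e then none else some (G.head i)) = b) ∨
      ((i.elim none fun i => some (G.tail i)) = b ∧
        (i.elim (some (G.head e)) fun i => if i = e then none else some (G.head i)) = a)
    have hsymm : ∀ a b, Relation.ReflTransGen r a b → Relation.ReflTransGen r b a := by
      have : Std.Symm r := ⟨fun a b ⟨i, hi⟩ => ⟨i, hi.symm⟩⟩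
      exact fun a b h => Relation.ReflTransGen.stdSymm.symm a b h
    have h1 : Relation.ReflTransGen r (some (G.tail e)) none :=
      .single ⟨some e, .inl ⟨rfl, if_pos rfl⟩⟩
    have h2 : Relation.ReflTransGen r none (some (G.head e)) := .single ⟨none, .inl ⟨rfl, rfl⟩⟩
    -- Old adjacencies survive, that of `e` through the new vertex `none`.
    have hedge : ∀ i, Relation.ReflTransGen r (some (G.tail i)) (some (G.head i)) := by
      intro i
      rcases eq_or_ne i e with rfl | hi
      · exact h1.trans h2
      · exact .single ⟨some i, .inl ⟨rfl, if_neg hi⟩⟩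
    have hold : ∀ x y, Relation.ReflTransGen r (some x) (some y) := by
      intro x y
      induction G.connected x y with
      | refl => exact .refl
      | tail _ h ih =>
        obtain ⟨i, ⟨rfl, rfl⟩ | ⟨rfl, rfl⟩⟩ := h
        · exact ih.trans (hedge i)
        · exact ih.trans (hsymm _ _ (hedge i))
    have hto : ∀ a, Relation.ReflTransGen r (some (G.tail e)) a := by
      rintro (_ | x)
      · exact h1
      · exact hold _ x
    exact fun a b => (hsymm _ _ (hto a)).trans (hto b)
  pt := fun x => x.elim (G.seg e t) G.pt
  seg := fun i s => i.elim (G.seg e (t + s)) fun i => G.seg i s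
  pt_injective := by
    rintro (_ | x) (_ | y) h
    · rfl
    · exact absurd h (G.seg_ne_pt e t ht y)
    · exact absurd h.symm (G.seg_ne_pt e t ht x)
    · exact congrArg some (G.pt_injective h)
  seg_tail := by
    rintro (_ | i)
    · simp
    · exact G.seg_tail i
  seg_head := by
    rintro (_ | i)
    · simpa using G.seg_head e
    · rcases eq_or_ne i e with rfl | hi
      · simp
      · simpa [hi] using G.seg_head i
  seg_unitSpeed := by
    rintro (_ | i)
    · exact (G.seg_unitSpeed e).comp_const_add ht.1.le (by simp)
    · rcases eq_or_ne i e with rfl | hi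
      · simpa using (G.seg_unitSpeed i).comp_const_add (a := 0) (b := t) le_rfl
          (by simpa using ht.2.le)
      · simpa [hi] using G.seg_unitSpeed i
  seg_ne_pt := by
    rintro (_ | i) s hs (_ | x) h
    · have hs' : s ∈ Set.Ioo 0 (G.len e - t) := hs
      have h' := (G.seg_inj e (t + s) ⟨by linarith [hs'.1, ht.1], by linarith [hs'.2]⟩ e t ht h).2
      linarith [hs'.1]
    · have hs' : s ∈ Set.Ioo 0 (G.len e - t) := hs
      exact G.seg_ne_pt e (t + s) ⟨by linarith [hs'.1, ht.1], by linarith [hs'.2]⟩ x h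
    · rcases eq_or_ne i e with rfl | hi
      · have hs' : s ∈ Set.Ioo 0 t := by simpa using hs
        have h' := (G.seg_inj i s ⟨hs'.1, hs'.2.trans ht.2⟩ i t ht h).2
        exact hs'.2.ne h'
      · have hs' : s ∈ Set.Ioo 0 (G.len i) := by simpa [hi] using hs
        exact hi (G.seg_inj i s hs' e t ht h).1
    · rcases eq_or_ne i e with rfl | hi
      · have hs' : s ∈ Set.Ioo 0 t := by simpa using hs
        exact G.seg_ne_pt i s ⟨hs'.1, hs'.2.trans ht.2⟩ x h
      · have hs' : s ∈ Set.Ioo 0 (G.len i) := by simpa [hi] using hs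
        exact G.seg_ne_pt i s hs' x h
  seg_inj := by
    have hlast : ∀ s ∈ Set.Ioo 0 (G.len e - t), t + s ∈ Set.Ioo 0 (G.len e) := fun s hs =>
      ⟨by linarith [hs.1, ht.1], by linarith [hs.2]⟩
    have hold : ∀ i, ∀ s ∈ Set.Ioo 0 (if i = e then t else G.len i), s ∈ Set.Ioo 0 (G.len i) := by
      intro i s hs
      split_ifs at hs with hi
      · exact ⟨hs.1, hi ▸ hs.2.trans ht.2⟩
      · exact hs
    -- The two halves of `e` lie at parameters above and below `t`.
    have hmixed : ∀ s ∈ Set.Ioo 0 (G.len e - t), ∀ i,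
        ∀ s' ∈ Set.Ioo 0 (if i = e then t else G.len i), G.seg e (t + s) ≠ G.seg i s' := by
      intro s hs i s' hs' h
      obtain ⟨rfl, h'⟩ := G.seg_inj _ _ (hlast s hs) _ _ (hold i s' hs') h
      rw [if_pos rfl] at hs'
      linarith [hs'.2, hs.1]
    rintro (_ | i) s hs (_ | j) s' hs' h
    · exact ⟨rfl, add_left_cancel (G.seg_inj _ _ (hlast s hs) _ _ (hlast s' hs') h).2⟩
    · exact absurd h (hmixed s hs j s' hs')
    · exact absurd h.symm (hmixed s' hs' i s hs)
    · obtain ⟨h1, h2⟩ := G.seg_inj _ _ (hold i s hs) _ _ (hold j s' hs') h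
      exact ⟨congrArg some h1, h2⟩
  cover := by
    intro q
    obtain ⟨x, hx⟩ | ⟨i, s, hs, h⟩ := G.cover q
    · exact .inl ⟨some x, hx⟩
    rcases eq_or_ne i e with rfl | hi
    · rcases lt_trichotomy s t with hst | rfl | hst
      · exact .inr ⟨some i, s, ⟨hs.1, by simpa using hst⟩, h⟩
      · exact .inl ⟨none, h⟩
      · refine .inr ⟨none, s - t, ⟨sub_pos.2 hst, sub_lt_sub_right hs.2 t⟩, ?_⟩
        simpa using h
    · exact .inr ⟨some i, s, by simpa [hi] using hs, h⟩

theorem refines_subdivide (G : Model.{u, v} Γ) (e : G.E) (t : ℝ) (ht : t ∈ Set.Ioo 0 (G.len e)) :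
    Refines G (G.subdivide e t ht) fun i => i.elim e id where
  vertex x := ⟨some x, rfl⟩
  edge := by
    classical
    rintro (_ | i)
    · refine ⟨t, ht.1.le, ?_, fun s _ => rfl⟩
      change t + (G.len e - t) ≤ G.len e
      linarith
    · refine ⟨0, le_rfl, ?_, fun s _ => ?_⟩
      · change 0 + (if i = e then t else G.len i) ≤ G.len i
        split_ifs with hi
        · rw [zero_add, hi]; exact ht.2.le
        · rw [zero_add]
      · change G.seg i s = G.seg i (0 + s)
        rw [zero_add]

theorem exists_refinement_through (G : Model.{u, v} Γ) (q : Γ) :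
    ∃ (G' : Model.{u, v} Γ) (b : G'.E → G.E), Refines G G' b ∧ ∃ z, G'.pt z = q := by
  obtain ⟨x, hx⟩ | ⟨e, t, ht, h⟩ := G.cover q
  · exact ⟨G, id, .refl G, x, hx⟩
  · exact ⟨_, _, G.refines_subdivide e t ht, none, h⟩

/-- Subdividing at `p` and then at `q` keeps `p` a vertex; connectedness supplies the path. -/
theorem exists_isAbelJacobiValue (p q : Γ) : ∃ x, G₀.IsAbelJacobiValue p q x := by
  obtain ⟨G, b, hG, y, hy⟩ := G₀.exists_refinement_through p
  obtain ⟨G', b', hG', z, hz⟩ := G.exists_refinement_through q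
  obtain ⟨y', hy'⟩ := hG'.vertex y
  obtain ⟨P⟩ := WeightedGraph.nonempty_path y' z
  exact ⟨_, G', b ∘ b', hG.trans hG', y', z, P, hy'.trans hy, hz, rfl⟩

theorem abelJacobi_eq {A : Γ → G₀.Jac}
    (hA : ∀ e, ∀ t ∈ Set.Icc 0 (G₀.len e), A (G₀.seg e t) = G₀.edgePoint e t) (p q : Γ) :
    G₀.abelJacobi p q = A q - A p := by
  obtain ⟨G, b, hG, y, z, P, rfl, rfl, h⟩ :=
    Classical.epsilon_spec (exists_isAbelJacobiValue (G₀ := G₀) p q)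
  exact h.trans (mk_transfer_chain hA hG P)

end Model

end Tropical

theorem mainTheorem5 {Γ : Type u} [MetricSpace Γ] (hΓ : Tropical.IsTropicalCurve Γ)
    (G₀ : Tropical.Model.{u, v} Γ) (p : Γ) (e : G₀.E) :
    eVariationOn (fun t : ℝ => G₀.abelJacobi p (G₀.seg e t)) (Set.Icc 0 (G₀.len e)) =
      ENNReal.ofReal (√(G₀.len e * G₀.foster e)) := by
  obtain ⟨A, hA⟩ := G₀.exists_torus_map
  -- The base point enters only through the translation by `A p`.
  rw [eVariationOn.congr (g := fun t => G₀.edgePoint e t - A p)]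
  · rw [← G₀.norm_proj_edge]
    exact G₀.eVariationOn_mk_integration (A p) _ _ (G₀.len_pos e)
  · intro t ht
    beta_reduce
    rw [Tropical.Model.abelJacobi_eq hA, hA e t ht]
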